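/- Parametrize the hypergeometric series ${}_3F_2(a,b,c;d,e;1)$ by $(a,b,c;d,e)\in\mathbb{C}^3\times\mathbb{C}^2$, and ${}_2F_1(a,b;c;-1)$ by $(a,b;c)\in\mathbb{C}^2\times\mathbb{C}^1$. Let $\mathfrak{T}\subset GL(5,\mathbb{C})$ be the Thomae group, of order $5!$: in the coordinates $(x,y,z;u,v)$ defined by $$a=x+u+v,\quad b=y+u+v,\quad c=z+u+v,\quad d=x+y+z+2u+v,\quad e=x+y+z+u+2v,$$ it consists of all permutations of $x,y,z,u,v$. Let $$\mathcal{V}_0=\{(a,b,c;d,e)\mid a+b+c=(d-1)+(e-1),\ ab+bc+ca=(d-1)(e-1)\}$$ be the Slater variety and $\mathcal{W}_0=\{(\alpha,\alpha+\tfrac12,\beta;\gamma,\gamma+\tfrac12)\}$ the $3$-plane of Whipple's identity, which relates ${}_2F_1(2\alpha,\beta;2\gamma-\beta;-1)$ to ${}_3F_2(\alpha,\tfrac12+\alpha,\beta;\gamma,\tfrac12+\gamma;1)$. The Slater orbit is $\{T\mathcal{V}_0\mid T\in\mathfrak{T}\}$ and the Whipple ${}_2F_1(-1)$ orbit is $\{T\mathcal{W}_0\mid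 T\in\mathfrak{T}\}$. Let $P:\mathcal{W}_0\to\mathbb{C}^2\times\mathbb{C}^1$ be the map $(\alpha,\alpha+\tfrac12,\beta;\gamma,\gamma+\tfrac12)\mapsto(2\alpha,\beta;2\gamma-\beta)$; a $3$-plane $T\mathcal{W}_0$ is projected to $\mathbb{C}^2\times\mathbb{C}^1$ by $PT^{-1}$. For $\nu\in\mathbb{C}$ let $\mathcal{K}_\nu=\{(a+\nu,b;a-b)\mid a,b\in\mathbb{C}\}$; the Kummer $2$-plane is $\mathcal{K}_{-1}=\{(a,b;1+a-b)\}$. Let $X\subset\mathbb{C}^2\times\mathbb{C}^1$ be the union of all projections by $PT^{-1}$ of the sets $\mathcal{V}\cap T\mathcal{W}_0$, where $\mathcal{V}$ is on the Slater orbit and $T\in\mathfrak{T}$. Up to the group generated by the permutation $(a,b;c)\mapsto(b,a;c)$ and Euler's transformation $(a,b;c)\mapsto(c-a,c-b;c)$, the set $X$ comprises, besides the trivial line $\{(a,0;a+2)\mid a\in\mathbb{C}\}$, on which the series is identically $1$, exactly the following components, no two of which are equivalent under this group, and no line among which is equivalent to the trivial line: (a) three lines that lie in the Kummer $2$-plane;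 (b) one line that lies in the displaced $2$-plane $\mathcal{K}_{-4}$ and is not equivalent to a line in the Kummer $2$-plane; and (c) the two algebraic curves $$\{(\beta-2\alpha+3,\,3;\,\beta+3)\mid 2(\alpha-\beta)^2-3\alpha+4\beta+1=0\},$$ $$\{(\beta-2\alpha+4,\,4;\,\beta+4)\mid 2(\alpha-\beta)^2-3\alpha+6\beta+1=0\},$$ which are irreducible, of dimension one, and not lines. The two curves correspond to the following identities. (i) If $2(\alpha-\beta)^2-3\alpha+4\beta+1=0$, then $${}_2F_1(\beta-2\alpha+3,\,3;\,\beta+3;\,-1)=\frac14\left[\frac{(\beta+1)(\beta+2)}{2\beta-2\alpha+3}\right].$$ (ii) If $2(\alpha-\beta)^2-3\alpha+6\beta+1=0$, then $${}_2F_1(\beta-2\alpha+4,\,4;\,\beta+4;\,-1)=\frac14\left[\frac{(\beta+1)(\beta+2)(\beta+3)}{(2\beta-2\alpha+4)(2\beta-2\alpha+5)}\right].$$ In both (i) and (ii) it is assumed that the series converges (possibly only conditionally), its lower parameter not being a non-positive integer. -/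

import Mathlib

open Filter Topology

noncomputable section

namespace Hypergeometric

/-- Parameter vectors `(a, b, c; d, e)` of `₃F₂(1)`, i.e. points of `ℂ³ × ℂ²`, as row vectors. -/
abbrev Params32 : Type := Fin 5 → ℂ

/-- Parameter vectors `(a, b; c)` of `₂F₁(-1)`, i.e. points of `ℂ² × ℂ¹`. -/
abbrev Params21 : Type := Fin 3 → ℂ

/-! ### The Thomae group and the two orbits -/

/-- The matrix relating the two parametrizations of `₃F₂(1)`:
`(a, b, c; d, e) = (x, y, z; u, v) A`. -/
def thomaeMatrix : Matrix (Fin 5) (Fin 5) ℂ :=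
  !![1, 0, 0, 1, 1;
     0, 1, 0, 1, 1;
     0, 0, 1, 1, 1;
     1, 1, 1, 2, 1;
     1, 1, 1, 1, 2]

/-- The Thomae group: the linear automorphisms of the parameter space that permute the
coordinates `(x, y, z, u, v)`.  It contains one element for each of the `5!` permutations,
because `thomaeMatrix` is invertible. -/
def thomaeGroup : Subgroup (Params32 ≃ₗ[ℂ] Params32) where
  carrier := {T | ∃ σ : Equiv.Perm (Fin 5), ∀ x : Fin 5 → ℂ,
    T (Matrix.vecMul x thomaeMatrix) = Matrix.vecMul (x ∘ σ) thomaeMatrix}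
  one_mem' := ⟨1, fun _ => rfl⟩
  mul_mem' := by
    rintro S T ⟨σ, hσ⟩ ⟨τ, hτ⟩
    refine ⟨τ * σ, fun x => ?_⟩
    rw [LinearEquiv.mul_apply, hτ, hσ]
    rfl
  inv_mem' := by
    rintro T ⟨σ, hσ⟩
    refine ⟨σ⁻¹, fun x => ?_⟩
    have h := hσ (x ∘ (σ⁻¹ : Equiv.Perm (Fin 5)))
    have h2 : (x ∘ (σ⁻¹ : Equiv.Perm (Fin 5))) ∘ σ = x := by
      funext i
      simp
    rw [h2] at h
    rw [← h]
    exact T.symm_apply_apply _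

/-- The variety `𝓤₂`, cut out of `ℂ³ × ℂ²` by equating the first and the second elementary
symmetric polynomials of the upper and of the lower parameters. -/
def euler2Variety : Set Params32 :=
  {p | p 0 + p 1 + p 2 = p 3 + p 4 ∧ p 0 * p 1 + p 0 * p 2 + p 1 * p 2 = p 3 * p 4}

/-- The Slater variety: all `(α₁, α₂, α₃; β₁ + 1, β₂ + 1)` with `(α; β) ∈ 𝓤₂`. -/
def slaterVariety : Set Params32 :=
  {p | ![p 0, p 1, p 2, p 3 - 1, p 4 - 1] ∈ euler2Variety}

/-- The orbit of the Slater variety under the Thomae group. -/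
def slaterOrbit : Set (Set Params32) :=
  {V | ∃ T ∈ thomaeGroup, V = T '' slaterVariety}

/-- The `3`-plane `𝓦₀ = {(α, α + 1/2, β; γ, γ + 1/2)}` of Whipple's identity
`₂F₁(2α, β; 2γ - β; -1) = Γ[…] ₃F₂(α, 1/2 + α, β; γ, 1/2 + γ; 1)`. -/
def whipplePlane : Set Params32 :=
  {p | p 1 = p 0 + 1 / 2 ∧ p 4 = p 3 + 1 / 2}

/-- The map `(α, α + 1/2, β; γ, γ + 1/2) ↦ (2α, β; 2γ - β)` of Whipple's identity. -/
def whippleProj (p : Params32) : Params21 :=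
  ![2 * p 0, p 2, 2 * p 3 - p 2]

/-- All points of the varieties `V` on the Slater orbit that lie on a `3`-plane `T 𝓦₀` of the
Whipple orbit, projected to `ℂ² × ℂ¹` by the map `P T⁻¹`, where `P` is `whippleProj`. -/
def projectedIntersection : Set Params21 :=
  {q | ∃ V ∈ slaterOrbit, ∃ T ∈ thomaeGroup,
    ∃ p ∈ V ∩ T '' whipplePlane, q = whippleProj (T⁻¹ p)}

/-! ### The symmetries of `₂F₁(-1)` -/

/-- Permutation of the upper parameters, `(a, b; c) ↦ (b, a; c)`. -/
def swapUpper : Equiv.Perm Params21 :=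
  Function.Involutive.toPerm (fun q => ![q 1, q 0, q 2]) (by
    intro q
    funext i
    fin_cases i <;> simp)

/-- Euler's transformation, `(a, b; c) ↦ (c - a, c - b; c)`. -/
def eulerMap : Equiv.Perm Params21 :=
  Function.Involutive.toPerm (fun q => ![q 2 - q 0, q 2 - q 1, q 2]) (by
    intro q
    funext i
    fin_cases i <;> simp)

/-- The group generated by the permutation of the upper parameters and Euler's transformation. -/
def symmetryGroup : Subgroup (Equiv.Perm Params21) :=
  Subgroup.closure {swapUpper, eulerMap}

/-- All images of the points of `S` under permutation and Euler's transformation. -/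
def saturation (S : Set Params21) : Set Params21 :=
  {q | ∃ g ∈ symmetryGroup, ∃ p ∈ S, q = g p}

/-- Two subsets of `ℂ² × ℂ¹` that agree up to permutation and Euler's transformation. -/
def Equivalent (S S' : Set Params21) : Prop :=
  ∃ g ∈ symmetryGroup, g '' S = S'

/-! ### Lines, planes and curves in `ℂ² × ℂ¹` -/

/-- A (complex affine) line. -/
def IsLine (S : Set Params21) : Prop :=
  ∃ p v : Params21, v ≠ 0 ∧ S = {q | ∃ t : ℂ, q = p + t • v}

/-- An irreducible algebraic curve: the zero set of a prime ideal of polynomials, of dimension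
one. -/
def IsAlgebraicCurve (S : Set Params21) : Prop :=
  ∃ I : Ideal (MvPolynomial (Fin 3) ℂ), I.IsPrime ∧
    ringKrullDim (MvPolynomial (Fin 3) ℂ ⧸ I) = 1 ∧
    S = {q | ∀ f ∈ I, MvPolynomial.eval q f = 0}

/-- The Kummer `2`-plane: the well-poised parameters `(a, b; 1 + a - b)`. -/
def kummerPlane : Set Params21 :=
  {q | ∃ a b : ℂ, q = ![a, b, 1 + a - b]}

/-- The displaced `2`-plane `{(a + ν, b; a - b)}`; it is the Kummer plane when `ν = -1`. -/
def displacedPlane (ν : ℂ) : Set Params21 :=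
  {q | ∃ a b : ℂ, q = ![a + ν, b, a - b]}

/-- The trivial line `{(a, 0; a + 2)}`, on which the series is identically `1`. -/
def trivialLine : Set Params21 :=
  {q | ∃ a : ℂ, q = ![a, 0, a + 2]}

/-- The first nonlinear curve. -/
def nonlinearCurve₁ : Set Params21 :=
  {q | ∃ α β : ℂ, 2 * (α - β) ^ 2 - 3 * α + 4 * β + 1 = 0 ∧
    q = ![β - 2 * α + 3, 3, β + 3]}

/-- The second nonlinear curve. -/
def nonlinearCurve₂ : Set Params21 :=
  {q | ∃ α β : ℂ, 2 * (α - β) ^ 2 - 3 * α + 6 * β + 1 = 0 ∧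
    q = ![β - 2 * α + 4, 4, β + 4]}

/-! ### The series -/

/-- The series `₂F₁(a, b; c; x)` is defined (`c` is not a non-positive integer) and converges,
possibly only conditionally, to `s`. -/
def HasSum21 (a b c x s : ℂ) : Prop :=
  (∀ n : ℕ, c ≠ -(n : ℂ)) ∧
    Tendsto (fun N : ℕ => ∑ k ∈ Finset.range N, ordinaryHypergeometricCoefficient a b c k * x ^ k)
      atTop (𝓝 s)

end Hypergeometric

end

namespace Hypergeometric

/-! ### The symmetry group -/

/-! Pulling back by `T` turns the projection of `V ∩ T 𝓦₀` into the image under `P` of `T⁻¹ V ∩ 𝓦₀`,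
so only the intersections of the fixed plane `𝓦₀` with the Slater orbit matter. In Thomae
coordinates `𝓦₀` is `y = x + 1/2`, `v = u + 1/2`, and the Slater variety is given by one linear and
one quadratic equation, symmetric in the coordinates apart from the marked pair `{u, v}`. Hence the
orbit has one member for each unordered pair of indices, ten in all. As `P` identifies `𝓦₀` with
`ℂ³`, each pair cuts out a plane section of a quadric: a line, two lines or a conic
(`mem_projectedIntersection`, `projectedIntersection_subset`). The symmetry group is a Klein
four-group, which identifies some of these pieces; inequivalence is a check on four maps.

The conics are parametrized polynomially by `t = α - β`, with `t` an affine function of the point,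
so their coordinate ring is `ℂ[t]`.

For the evaluations, an upper parameter 3 or 4 makes each term a polynomial in `k` times a ratio of
Pochhammer symbols. On the curve these terms are differences `S (k + 1) - S k` of an explicit
sequence. Since `S k` is a convergent factor times the `k`-th term, convergence of the series alone
forces `S` to tend to zero, and the sum is `-S 0`. -/

theorem swapUpper_apply (q : Params21) : swapUpper q = ![q 1, q 0, q 2] := rfl

theorem eulerMap_apply (q : Params21) : eulerMap q = ![q 2 - q 0, q 2 - q 1, q 2] := rfl

theorem swapUpper_mul_swapUpper : swapUpper * swapUpper = 1 := by
  ext q i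
  fin_cases i <;> rfl

theorem eulerMap_mul_eulerMap : eulerMap * eulerMap = 1 := by
  ext q i
  fin_cases i <;> simp [eulerMap_apply]

theorem eulerMap_mul_swapUpper : eulerMap * swapUpper = swapUpper * eulerMap := by
  ext q i
  fin_cases i <;> rfl

theorem swapUpper_mem : swapUpper ∈ symmetryGroup := Subgroup.subset_closure (by simp)

theorem eulerMap_mem : eulerMap ∈ symmetryGroup := Subgroup.subset_closure (by simp)

/-- The two generators are commuting involutions. -/
theorem mem_symmetryGroup {g : Equiv.Perm Params21} (hg : g ∈ symmetryGroup) :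
    g = 1 ∨ g = swapUpper ∨ g = eulerMap ∨ g = swapUpper * eulerMap := by
  have hs (k : Equiv.Perm Params21) : swapUpper * (swapUpper * k) = k := by
    rw [← mul_assoc, swapUpper_mul_swapUpper, one_mul]
  have he (k : Equiv.Perm Params21) : eulerMap * (swapUpper * k) = swapUpper * (eulerMap * k) := by
    rw [← mul_assoc, eulerMap_mul_swapUpper, mul_assoc]
  induction hg using Subgroup.closure_induction with
  | mem x hx => rcases hx with rfl | rfl <;> simp
  | one => simp
  | mul x y _ _ hx hy =>
    rcases hx with rfl | rfl | rfl | rfl <;> rcases hy with rfl | rfl | rfl | rfl <;>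
      simp [mul_assoc, hs, he, swapUpper_mul_swapUpper, eulerMap_mul_eulerMap,
        eulerMap_mul_swapUpper]
  | inv x _ hx =>
    have h1 : swapUpper⁻¹ = swapUpper := inv_eq_of_mul_eq_one_left swapUpper_mul_swapUpper
    have h2 : eulerMap⁻¹ = eulerMap := inv_eq_of_mul_eq_one_left eulerMap_mul_eulerMap
    rcases hx with rfl | rfl | rfl | rfl <;> simp [h1, h2, eulerMap_mul_swapUpper]

/-- A property of all symmetries can be checked on the four of them. -/
theorem forall_mem_symmetryGroup {p : (Params21 → Params21) → Prop}
    (h1 : p fun q => q) (h2 : p fun q => ![q 1, q 0, q 2])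
    (h3 : p fun q => ![q 2 - q 0, q 2 - q 1, q 2])
    (h4 : p fun q => ![q 2 - q 1, q 2 - q 0, q 2]) :
    ∀ g ∈ symmetryGroup, p g := by
  intro g hg
  rcases mem_symmetryGroup hg with rfl | rfl | rfl | rfl
  exacts [h1, h2, h3, h4]

theorem saturation_subset_saturation {S S' : Set Params21} (h : S ⊆ saturation S') :
    saturation S ⊆ saturation S' := by
  rintro _ ⟨g, hg, p, hp, rfl⟩
  obtain ⟨k, hk, r, hr, rfl⟩ := h hp
  exact ⟨g * k, mul_mem hg hk, r, hr, rfl⟩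

theorem mem_saturation_of_mem {S : Set Params21} {q : Params21} (h : q ∈ S) : q ∈ saturation S :=
  ⟨1, one_mem _, q, h, rfl⟩

theorem mem_saturation_of_swap {S : Set Params21} {q : Params21} (h : ![q 1, q 0, q 2] ∈ S) :
    q ∈ saturation S :=
  ⟨swapUpper, swapUpper_mem, _, h, by ext i; fin_cases i <;> rfl⟩

theorem mem_saturation_of_euler {S : Set Params21} {q : Params21}
    (h : ![q 2 - q 0, q 2 - q 1, q 2] ∈ S) : q ∈ saturation S :=
  ⟨eulerMap, eulerMap_mem, _, h, by ext i; fin_cases i <;> simp [eulerMap_apply]⟩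

theorem mem_saturation_of_swap_euler {S : Set Params21} {q : Params21}
    (h : ![q 2 - q 1, q 2 - q 0, q 2] ∈ S) : q ∈ saturation S :=
  ⟨swapUpper * eulerMap, mul_mem swapUpper_mem eulerMap_mem, _, h, by
    ext i; fin_cases i <;> simp [eulerMap_apply, swapUpper_apply]⟩

/-! ### The Thomae group -/

/-- The change of coordinates from `(x, y, z; u, v)` to `(a, b, c; d, e)`. -/
noncomputable def thomaeEquiv : (Fin 5 → ℂ) ≃ₗ[ℂ] Params32 where
  toFun x := Matrix.vecMul x thomaeMatrix
  map_add' x y := Matrix.add_vecMul _ x y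
  map_smul' c x := Matrix.smul_vecMul c x _
  invFun p :=
    let w := (2 * (p 0 + p 1 + p 2) - (p 3 + p 4)) / 3
    let s := p 3 + p 4 - p 0 - p 1 - p 2
    ![p 0 - w, p 1 - w, p 2 - w, p 3 - s - w, p 4 - s - w]
  left_inv x := by
    funext i
    fin_cases i <;>
      simp [thomaeMatrix, Matrix.vecMul, dotProduct, Fin.sum_univ_five] <;> ring
  right_inv p := by
    funext i
    fin_cases i <;>
      simp [thomaeMatrix, Matrix.vecMul, dotProduct, Fin.sum_univ_five] <;> ring

theorem vecMul_thomaeMatrix (x : Fin 5 → ℂ) : Matrix.vecMul x thomaeMatrix =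
    ![x 0 + x 3 + x 4, x 1 + x 3 + x 4, x 2 + x 3 + x 4,
      x 0 + x 1 + x 2 + 2 * x 3 + x 4, x 0 + x 1 + x 2 + x 3 + 2 * x 4] := by
  funext i
  fin_cases i <;>
    simp [thomaeMatrix, Matrix.vecMul, dotProduct, Fin.sum_univ_five] <;> ring

theorem exists_mem_thomaeGroup (σ : Equiv.Perm (Fin 5)) :
    ∃ T ∈ thomaeGroup, ∀ x : Fin 5 → ℂ,
      T (Matrix.vecMul x thomaeMatrix) = Matrix.vecMul (x ∘ σ) thomaeMatrix := by
  have h (x : Fin 5 → ℂ) : (thomaeEquiv.symm ≪≫ₗ LinearEquiv.funCongrLeft ℂ ℂ σ ≪≫ₗ thomaeEquiv)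
      (Matrix.vecMul x thomaeMatrix) = Matrix.vecMul (x ∘ σ) thomaeMatrix := by
    change thomaeEquiv (LinearEquiv.funCongrLeft ℂ ℂ σ (thomaeEquiv.symm (thomaeEquiv x))) = _
    rw [LinearEquiv.symm_apply_apply]
    rfl
  exact ⟨_, ⟨σ, h⟩, h⟩

/-- Only the images of 3 and 4 need prescribing, because the Slater equations are symmetric in the
first three coordinates. -/
theorem exists_perm_apply_eq {i j : Fin 5} (hij : i ≠ j) :
    ∃ σ : Equiv.Perm (Fin 5), σ 3 = i ∧ σ 4 = j := by
  refine ⟨Equiv.swap 3 i * Equiv.swap 4 (Equiv.swap 3 i j), ?_, by simp⟩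
  have h : (3 : Fin 5) ≠ Equiv.swap 3 i j := fun h => hij <| by
    rw [← Equiv.swap_apply_left 3 i]
    exact (congrArg (Equiv.swap 3 i) h).trans (Equiv.swap_apply_self 3 i j)
  rw [Equiv.Perm.mul_apply, Equiv.swap_apply_of_ne_of_ne (by decide) h, Equiv.swap_apply_left]

/-- The Slater variety in the coordinates `(x, y, z; u, v)`. -/
theorem vecMul_mem_slaterVariety (y : Fin 5 → ℂ) :
    Matrix.vecMul y thomaeMatrix ∈ slaterVariety ↔
      ∑ k, y k = y 3 + y 4 + 2 ∧
      ∑ k, y k ^ 2 = 3 * y 3 ^ 2 + 3 * y 4 ^ 2 + 2 * y 3 * y 4 + 2 * y 3 + 2 * y 4 + 2 := by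
  simp only [slaterVariety, euler2Variety, vecMul_thomaeMatrix, Set.mem_ofPred_eq,
    Fin.sum_univ_five, Matrix.cons_val]
  constructor
  · rintro ⟨h1, h2⟩
    -- Since `y 0 + y 1 + y 2 = 2`, Newton's identity trades the second elementary symmetric
    -- polynomial for the sum of squares.
    have h3 : y 0 = 2 - y 1 - y 2 := by linear_combination -h1
    rw [h3] at h2 ⊢
    constructor
    · ring
    · linear_combination -2 * h2
  · rintro ⟨h1, h2⟩
    have h3 : y 0 = 2 - y 1 - y 2 := by linear_combination h1
    rw [h3] at h2 ⊢
    constructor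
    · ring
    · linear_combination -(1 / 2) * h2

/-- The coordinates `(x, y, z; u, v)` of a point of the Whipple plane. -/
noncomputable def whippleCoords (x z u : ℂ) : Fin 5 → ℂ := ![x, x + 1 / 2, z, u, u + 1 / 2]

/-- The condition that the coordinates `w`, rearranged so that the `i`-th and the `j`-th come last,
belong to a point of the Slater variety. -/
def IsSlaterPair (w : Fin 5 → ℂ) (i j : Fin 5) : Prop :=
  ∑ k, w k = w i + w j + 2 ∧
    ∑ k, w k ^ 2 = 3 * w i ^ 2 + 3 * w j ^ 2 + 2 * w i * w j + 2 * w i + 2 * w j + 2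

theorem IsSlaterPair.symm {w : Fin 5 → ℂ} {i j : Fin 5} (h : IsSlaterPair w i j) :
    IsSlaterPair w j i :=
  ⟨by linear_combination h.1, by linear_combination h.2⟩

/-- The coordinates of the point of the Whipple plane above `q`. -/
noncomputable def whippleLift (q : Params21) : Fin 5 → ℂ :=
  whippleCoords ((2 * q 2 - 2 * q 1 - q 0 - 1) / 6) ((4 * q 1 - 4 * q 0 + 2 * q 2 - 1) / 6)
    ((2 * q 0 + q 1 - q 2 - 1) / 6)

/-- With `V = T' 𝓥₀`, only the permutation of `T'⁻¹ T` matters, and of it only which two indices it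
puts in the places of `u` and `v`. Conversely, every pair already occurs with `T = 1`. -/
theorem mem_projectedIntersection_iff_exists {q : Params21} :
    q ∈ projectedIntersection ↔ ∃ x z u : ℂ, ∃ i j : Fin 5, i ≠ j ∧
      IsSlaterPair (whippleCoords x z u) i j ∧
      q = ![2 * x + 4 * u + 1, z + 2 * u + 1 / 2, 4 * x + z + 4 * u + 3 / 2] := by
  have hP (x z u : ℂ) : whippleProj (Matrix.vecMul (whippleCoords x z u) thomaeMatrix) =
      ![2 * x + 4 * u + 1, z + 2 * u + 1 / 2, 4 * x + z + 4 * u + 3 / 2] := by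
    funext k
    fin_cases k <;> simp [whippleProj, vecMul_thomaeMatrix, whippleCoords] <;> ring
  constructor
  · rintro ⟨_, ⟨T', hT', rfl⟩, T, hT, p, ⟨⟨r, hr, hrp⟩, w, hw, hwp⟩, rfl⟩
    have hTw : T⁻¹ p = w := by rw [← hwp]; exact T.symm_apply_apply w
    have hR : (T'⁻¹ * T) w = r := by
      rw [LinearEquiv.mul_apply, hwp, ← hrp]; exact T'.symm_apply_apply r
    obtain ⟨σ, hσ⟩ := mul_mem (inv_mem hT') hT
    obtain ⟨x, rfl⟩ : ∃ x, Matrix.vecMul x thomaeMatrix = w :=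
      ⟨_, thomaeEquiv.apply_symm_apply w⟩
    have hx : x = whippleCoords (x 0) (x 2) (x 3) := by
      simp only [whipplePlane, vecMul_thomaeMatrix, Set.mem_ofPred_eq, Matrix.cons_val] at hw
      funext k
      fin_cases k <;> simp only [whippleCoords, Fin.reduceFinMk, Fin.zero_eta, Fin.mk_one,
        Matrix.cons_val]
      · linear_combination hw.1
      · linear_combination hw.2
    rw [hσ] at hR
    rw [← hR, vecMul_mem_slaterVariety] at hr
    refine ⟨x 0, x 2, x 3, σ 3, σ 4, by simp, ?_⟩
    rw [hTw, ← hP, ← hx]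
    -- Sums over all five coordinates are invariant under `σ`, so only `σ 3` and `σ 4` survive in
    -- the equations.
    have e1 := Equiv.sum_comp σ x
    have e2 := Equiv.sum_comp σ fun k => x k ^ 2
    simp only [Function.comp_apply] at hr
    exact ⟨⟨e1 ▸ hr.1, e2 ▸ hr.2⟩, rfl⟩
  · rintro ⟨x, z, u, i, j, hij, ⟨h1, h2⟩, rfl⟩
    obtain ⟨σ, rfl, rfl⟩ := exists_perm_apply_eq hij
    obtain ⟨T, hT, hTσ⟩ := exists_mem_thomaeGroup σ
    set w := whippleCoords x z u with hw
    refine ⟨(T⁻¹ : Params32 ≃ₗ[ℂ] Params32) '' slaterVariety, ⟨T⁻¹, inv_mem hT, rfl⟩, 1, one_mem _,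
      Matrix.vecMul w thomaeMatrix, ⟨⟨T (Matrix.vecMul w thomaeMatrix), ?_,
        T.symm_apply_apply _⟩, Matrix.vecMul w thomaeMatrix, ?_, rfl⟩, ?_⟩
    · rw [hTσ, vecMul_mem_slaterVariety]
      have e1 := Equiv.sum_comp σ w
      have e2 := Equiv.sum_comp σ fun k => w k ^ 2
      simp only [Function.comp_apply]
      exact ⟨e1 ▸ h1, e2 ▸ h2⟩
    · rw [hw, vecMul_thomaeMatrix]
      simp only [whipplePlane, whippleCoords, Set.mem_ofPred_eq, Matrix.cons_val]
      constructor <;> ring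
    · rw [inv_one]
      exact (hP x z u).symm

/-- `P` is a bijection from the Whipple plane to `ℂ³`, and `whippleLift` gives its inverse in Thomae
coordinates. -/
theorem mem_projectedIntersection {q : Params21} :
    q ∈ projectedIntersection ↔ ∃ i j : Fin 5, i ≠ j ∧ IsSlaterPair (whippleLift q) i j := by
  rw [mem_projectedIntersection_iff_exists]
  constructor
  · rintro ⟨x, z, u, i, j, hij, h, rfl⟩
    refine ⟨i, j, hij, ?_⟩
    convert h using 1
    simp only [whippleLift, Matrix.cons_val]
    congr 1 <;> ring
  · rintro ⟨i, j, hij, h⟩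
    refine ⟨_, _, _, i, j, hij, h, ?_⟩
    funext k
    fin_cases k <;> simp <;> ring

/-! ### The components -/

/-- The line through `p` with direction `v`. -/
def lineThrough (p v : Params21) : Set Params21 := {q | ∃ t : ℂ, q = p + t • v}

/-- The four nontrivial lines of the intersection. -/
noncomputable def componentLine : Fin 4 → Set Params21 :=
  ![lineThrough ![2, 0, 3] ![0, 1, -1], lineThrough ![1, 0, 2] ![1, 1, 0],
    lineThrough ![2, 0, 3] ![1, 1, 0], lineThrough ![0, 1, 3] ![1, 2, -1]]

theorem isLine_componentLine (i : Fin 4) : IsLine (componentLine i) := by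
  fin_cases i
  · exact ⟨![2, 0, 3], ![0, 1, -1], fun h => by simpa using congrFun h 1, rfl⟩
  · exact ⟨![1, 0, 2], ![1, 1, 0], fun h => by simpa using congrFun h 1, rfl⟩
  · exact ⟨![2, 0, 3], ![1, 1, 0], fun h => by simpa using congrFun h 1, rfl⟩
  · exact ⟨![0, 1, 3], ![1, 2, -1], fun h => by simpa using congrFun h 1, rfl⟩

theorem mem_lineThrough {p v q : Params21} :
    q ∈ lineThrough p v ↔
      ∃ t : ℂ, q 0 = p 0 + t * v 0 ∧ q 1 = p 1 + t * v 1 ∧ q 2 = p 2 + t * v 2 := by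
  refine exists_congr fun t => ?_
  rw [funext_iff, Fin.forall_fin_succ, Fin.forall_fin_succ, Fin.forall_fin_one]
  rfl

theorem mem_componentLine_zero {q : Params21} :
    q ∈ componentLine 0 ↔ q 0 = 2 ∧ q 2 = 3 - q 1 := by
  change q ∈ lineThrough _ _ ↔ _
  simp only [mem_lineThrough, Matrix.cons_val]
  constructor
  · rintro ⟨t, h0, h1, h2⟩
    exact ⟨by linear_combination h0, by linear_combination h1 + h2⟩
  · rintro ⟨h0, h2⟩
    exact ⟨q 1, by linear_combination h0, by ring, by linear_combination h2⟩

theorem mem_componentLine_one {q : Params21} :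
    q ∈ componentLine 1 ↔ q 0 = q 1 + 1 ∧ q 2 = 2 := by
  change q ∈ lineThrough _ _ ↔ _
  simp only [mem_lineThrough, Matrix.cons_val]
  constructor
  · rintro ⟨t, h0, h1, h2⟩
    exact ⟨by linear_combination h0 - h1, by linear_combination h2⟩
  · rintro ⟨h0, h2⟩
    exact ⟨q 1, by linear_combination h0, by ring, by linear_combination h2⟩

theorem mem_componentLine_two {q : Params21} :
    q ∈ componentLine 2 ↔ q 0 = q 1 + 2 ∧ q 2 = 3 := by
  change q ∈ lineThrough _ _ ↔ _
  simp only [mem_lineThrough, Matrix.cons_val]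
  constructor
  · rintro ⟨t, h0, h1, h2⟩
    exact ⟨by linear_combination h0 - h1, by linear_combination h2⟩
  · rintro ⟨h0, h2⟩
    exact ⟨q 1, by linear_combination h0, by ring, by linear_combination h2⟩

theorem mem_componentLine_three {q : Params21} :
    q ∈ componentLine 3 ↔ q 1 = 2 * q 0 + 1 ∧ q 2 = 3 - q 0 := by
  change q ∈ lineThrough _ _ ↔ _
  simp only [mem_lineThrough, Matrix.cons_val]
  constructor
  · rintro ⟨t, h0, h1, h2⟩
    exact ⟨by linear_combination h1 - 2 * h0, by linear_combination h0 + h2⟩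
  · rintro ⟨h0, h2⟩
    exact ⟨q 0, by ring, by linear_combination h0, by linear_combination h2⟩

theorem mem_trivialLine {q : Params21} : q ∈ trivialLine ↔ q 1 = 0 ∧ q 2 = q 0 + 2 := by
  constructor
  · rintro ⟨a, rfl⟩
    simp
  · rintro ⟨h1, h2⟩
    refine ⟨q 0, ?_⟩
    funext i
    fin_cases i <;> simp [h1, h2]

theorem mem_kummerPlane {q : Params21} : q ∈ kummerPlane ↔ q 2 = 1 + q 0 - q 1 := by
  constructor
  · rintro ⟨a, b, rfl⟩
    simp
  · intro h
    refine ⟨q 0, q 1, ?_⟩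
    funext i
    fin_cases i <;> simp [h]

theorem mem_displacedPlane {ν : ℂ} {q : Params21} :
    q ∈ displacedPlane ν ↔ q 2 = q 0 - ν - q 1 := by
  constructor
  · rintro ⟨a, b, rfl⟩
    simp
  · intro h
    refine ⟨q 0 - ν, q 1, ?_⟩
    funext i
    fin_cases i <;> simp [h]

/-- On the plane `q 1 = 3` the parameters are affine in the point, `β = q 2 - 3` and `α = (q 2 - q
0) / 2`, so they can be eliminated. -/
theorem mem_nonlinearCurve₁ {q : Params21} :
    q ∈ nonlinearCurve₁ ↔ q 1 = 3 ∧ (q 0 + q 2) ^ 2 - 9 * q 0 - 7 * q 2 + 14 = 0 := by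
  constructor
  · rintro ⟨α, β, h, rfl⟩
    simp only [Matrix.cons_val, true_and]
    linear_combination 2 * h
  · rintro ⟨h1, h2⟩
    refine ⟨(q 2 - q 0) / 2, q 2 - 3, by linear_combination h2 / 2, ?_⟩
    funext i
    fin_cases i <;> simp [h1]
    ring

theorem mem_nonlinearCurve₂ {q : Params21} :
    q ∈ nonlinearCurve₂ ↔ q 1 = 4 ∧ (q 0 + q 2) ^ 2 - 13 * q 0 - 7 * q 2 + 18 = 0 := by
  constructor
  · rintro ⟨α, β, h, rfl⟩
    simp only [Matrix.cons_val, true_and]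
    linear_combination 2 * h
  · rintro ⟨h1, h2⟩
    refine ⟨(q 2 - q 0) / 2, q 2 - 4, by linear_combination h2 / 2, ?_⟩
    funext i
    fin_cases i <;> simp [h1]
    ring

/-- Equations for the union of the components. -/
theorem mem_components {q : Params21} :
    q ∈ (⋃ i, componentLine i) ∪ nonlinearCurve₁ ∪ nonlinearCurve₂ ∪ trivialLine ↔
      (q 0 = 2 ∧ q 2 = 3 - q 1) ∨ (q 0 = q 1 + 1 ∧ q 2 = 2) ∨ (q 0 = q 1 + 2 ∧ q 2 = 3) ∨
      (q 1 = 2 * q 0 + 1 ∧ q 2 = 3 - q 0) ∨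
      (q 1 = 3 ∧ (q 0 + q 2) ^ 2 - 9 * q 0 - 7 * q 2 + 14 = 0) ∨
      (q 1 = 4 ∧ (q 0 + q 2) ^ 2 - 13 * q 0 - 7 * q 2 + 18 = 0) ∨
      (q 1 = 0 ∧ q 2 = q 0 + 2) := by
  rw [← mem_componentLine_zero, ← mem_componentLine_one, ← mem_componentLine_two,
    ← mem_componentLine_three, ← mem_nonlinearCurve₁, ← mem_nonlinearCurve₂, ← mem_trivialLine]
  simp only [Set.mem_union, Set.mem_iUnion, Fin.exists_fin_succ, Fin.succ_zero_eq_one,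
    Fin.succ_one_eq_two, IsEmpty.exists_iff, or_false, or_assoc]
  rfl

/-! ### Matching the ten index pairs with the components -/

theorem components_subset : (⋃ i, componentLine i) ∪ nonlinearCurve₁ ∪ nonlinearCurve₂ ∪
    trivialLine ⊆ saturation projectedIntersection := by
  have key {q : Params21} (i j : Fin 5) (hij : i ≠ j) (h : IsSlaterPair (whippleLift q) i j) :
      q ∈ projectedIntersection := mem_projectedIntersection.2 ⟨i, j, hij, h⟩
  intro q hq
  rcases mem_components.1 hq with ⟨h0, h2⟩ | ⟨h0, h2⟩ | ⟨h0, h2⟩ | ⟨h1, h2⟩ | ⟨h1, h⟩ |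
    ⟨h1, h⟩ | ⟨h1, h2⟩
  · refine mem_saturation_of_swap (key 0 1 (by decide) ⟨?_, ?_⟩) <;>
      simp [whippleLift, whippleCoords, Fin.sum_univ_five, h0, h2] <;> ring
  · refine mem_saturation_of_swap (key 0 3 (by decide) ⟨?_, ?_⟩) <;>
      simp [whippleLift, whippleCoords, Fin.sum_univ_five, h0, h2] <;> ring
  · refine mem_saturation_of_swap (key 1 4 (by decide) ⟨?_, ?_⟩) <;>
      simp [whippleLift, whippleCoords, Fin.sum_univ_five, h0, h2] <;> ring
  · refine mem_saturation_of_mem (key 0 4 (by decide) ⟨?_, ?_⟩) <;>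
      simp [whippleLift, whippleCoords, Fin.sum_univ_five, h1, h2] <;> ring
  · refine mem_saturation_of_swap (key 0 2 (by decide) ⟨?_, ?_⟩) <;>
      simp [whippleLift, whippleCoords, Fin.sum_univ_five, h1]
    · ring
    · linear_combination -(1 / 2) * h
  · refine mem_saturation_of_swap (key 1 2 (by decide) ⟨?_, ?_⟩) <;>
      simp [whippleLift, whippleCoords, Fin.sum_univ_five, h1]
    · ring
    · linear_combination -(1 / 2) * h
  · refine mem_saturation_of_mem (key 3 4 (by decide) ⟨?_, ?_⟩) <;>
      simp [whippleLift, whippleCoords, Fin.sum_univ_five, h1, h2] <;> ring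

theorem projectedIntersection_subset : projectedIntersection ⊆
    saturation ((⋃ i, componentLine i) ∪ nonlinearCurve₁ ∪ nonlinearCurve₂ ∪ trivialLine) := by
  intro q hq
  obtain ⟨i, j, hij, h⟩ := mem_projectedIntersection.1 hq
  wlog hlt : i < j generalizing i j
  · exact this j i hij.symm h.symm (lt_of_le_of_ne (not_lt.1 hlt) hij.symm)
  obtain ⟨h1, h2⟩ := h
  fin_cases i <;> fin_cases j <;> first | exact absurd hlt (by decide) | skip
  all_goals
    simp only [whippleLift, whippleCoords, Fin.sum_univ_five, Fin.reduceFinMk, Fin.zero_eta,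
      Fin.mk_one, Matrix.cons_val] at h1 h2
  · have e : q 1 = 2 := by linear_combination h1
    rw [e] at h2
    -- Here the conic degenerates into two lines.
    have h : (q 2 - q 0) * (q 2 + q 0 - 3) = 0 := by linear_combination -2 * h2
    rcases mul_eq_zero.1 h with h | h
    · refine mem_saturation_of_swap_euler (mem_components.2 ?_)
      iterate 6 refine Or.inr ?_
      simp only [Matrix.cons_val]
      exact ⟨by linear_combination h, by linear_combination e⟩
    · refine mem_saturation_of_swap (mem_components.2 (Or.inl ?_))
      simp only [Matrix.cons_val]
      exact ⟨e, by linear_combination h⟩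
  · have e : q 0 = 3 := by linear_combination 2 * h1
    rw [e] at h2
    refine mem_saturation_of_swap (mem_components.2 ?_)
    iterate 4 refine Or.inr ?_
    refine Or.inl ?_
    simp only [Matrix.cons_val]
    exact ⟨e, by linear_combination -2 * h2⟩
  · have e : q 2 = q 0 - q 1 + 3 := by linear_combination 2 * h1
    rw [e] at h2
    refine mem_saturation_of_swap (mem_components.2 (Or.inr (Or.inl ?_)))
    simp only [Matrix.cons_val]
    exact ⟨by linear_combination h2, by linear_combination e - h2⟩
  · have e : q 2 = q 0 - q 1 + 4 := by linear_combination 2 * h1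
    rw [e] at h2
    refine mem_saturation_of_mem (mem_components.2 ?_)
    iterate 3 refine Or.inr ?_
    exact Or.inl ⟨by linear_combination h2, by linear_combination e - h2⟩
  · have e : q 0 = 4 := by linear_combination 2 * h1
    rw [e] at h2
    refine mem_saturation_of_swap (mem_components.2 ?_)
    iterate 5 refine Or.inr ?_
    refine Or.inl ?_
    simp only [Matrix.cons_val]
    exact ⟨e, by linear_combination -2 * h2⟩
  · have e : q 2 = q 0 - q 1 + 4 := by linear_combination 2 * h1
    rw [e] at h2
    have h : q 0 = (3 * q 1 - 5) / 2 := by linear_combination -(1 / 2) * h2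
    refine mem_saturation_of_swap_euler (mem_components.2 ?_)
    iterate 3 refine Or.inr ?_
    refine Or.inl ?_
    simp only [Matrix.cons_val]
    exact ⟨by linear_combination -e - 2 * h, by linear_combination 2 * e + 2 * h⟩
  · have e : q 2 = q 0 - q 1 + 5 := by linear_combination 2 * h1
    rw [e] at h2
    refine mem_saturation_of_swap (mem_components.2 (Or.inr (Or.inr (Or.inl ?_))))
    simp only [Matrix.cons_val]
    exact ⟨by linear_combination h2 / 3, by linear_combination e - h2 / 3⟩
  · have e : q 2 = q 1 + 3 := by linear_combination 2 * h1
    rw [e] at h2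
    refine mem_saturation_of_euler (mem_components.2 ?_)
    iterate 4 refine Or.inr ?_
    refine Or.inl ?_
    simp only [Matrix.cons_val]
    rw [e]
    exact ⟨by ring, by linear_combination -2 * h2⟩
  · have e : q 2 = q 1 + 4 := by linear_combination 2 * h1
    rw [e] at h2
    refine mem_saturation_of_euler (mem_components.2 ?_)
    iterate 5 refine Or.inr ?_
    refine Or.inl ?_
    simp only [Matrix.cons_val]
    rw [e]
    exact ⟨by ring, by linear_combination -2 * h2⟩
  · have e : q 2 = q 0 + 2 := by linear_combination h1
    rw [e] at h2
    -- The other degenerate conic.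
    have h : q 1 * (2 * q 0 - q 1 + 1) = 0 := by linear_combination -2 * h2
    rcases mul_eq_zero.1 h with h | h
    · refine mem_saturation_of_mem (mem_components.2 ?_)
      iterate 6 refine Or.inr ?_
      exact ⟨h, e⟩
    · refine mem_saturation_of_euler (mem_components.2 (Or.inl ?_))
      simp only [Matrix.cons_val]
      exact ⟨by linear_combination e, by linear_combination 2 * e + h⟩

theorem saturation_projectedIntersection : saturation projectedIntersection =
    saturation ((⋃ i, componentLine i) ∪ nonlinearCurve₁ ∪ nonlinearCurve₂ ∪ trivialLine) :=
  (saturation_subset_saturation projectedIntersection_subset).antisymm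
    (saturation_subset_saturation components_subset)

/-! ### Inequivalence of the components -/

/-- The point of the first line with upper parameter `t`. -/
theorem componentLine_zero_mem (t : ℂ) : ![2, t, 3 - t] ∈ componentLine 0 :=
  mem_componentLine_zero.2 ⟨rfl, rfl⟩

theorem componentLine_one_mem (t : ℂ) : ![t + 1, t, 2] ∈ componentLine 1 :=
  mem_componentLine_one.2 ⟨rfl, rfl⟩

theorem componentLine_two_mem (t : ℂ) : ![t + 2, t, 3] ∈ componentLine 2 :=
  mem_componentLine_two.2 ⟨rfl, rfl⟩

theorem componentLine_three_mem (t : ℂ) : ![t, 2 * t + 1, 3 - t] ∈ componentLine 3 :=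
  mem_componentLine_three.2 ⟨rfl, rfl⟩

theorem Equivalent.symm {S S' : Set Params21} (h : Equivalent S S') : Equivalent S' S := by
  obtain ⟨g, hg, rfl⟩ := h
  exact ⟨g⁻¹, inv_mem hg, g.symm_image_image S⟩

theorem not_equivalent {S S' : Set Params21}
    (h : ∀ g ∈ symmetryGroup, ∃ p ∈ S, g p ∉ S') : ¬ Equivalent S S' := by
  rintro ⟨g, hg, rfl⟩
  obtain ⟨p, hp, hp'⟩ := h g hg
  exact hp' ⟨p, hp, rfl⟩

theorem componentLine_subset_kummerPlane (i : Fin 4) (hi : i ≠ 3) :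
    componentLine i ⊆ kummerPlane := by
  intro q hq
  rw [mem_kummerPlane]
  fin_cases i
  · obtain ⟨h1, h2⟩ := mem_componentLine_zero.1 hq
    linear_combination h2 - h1
  · obtain ⟨h1, h2⟩ := mem_componentLine_one.1 hq
    linear_combination h2 - h1
  · obtain ⟨h1, h2⟩ := mem_componentLine_two.1 hq
    linear_combination h2 - h1
  · exact absurd rfl hi

theorem componentLine_subset_displacedPlane : componentLine 3 ⊆ displacedPlane (-4) := by
  intro q hq
  rw [mem_displacedPlane]
  obtain ⟨h1, h2⟩ := mem_componentLine_three.1 hq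
  linear_combination h1 + h2

theorem not_image_subset_kummerPlane :
    ∀ g ∈ symmetryGroup, ¬ g '' componentLine 3 ⊆ kummerPlane := by
  intro g hg hsub
  have key : ∃ t : ℂ, g ![t, 2 * t + 1, 3 - t] ∉ kummerPlane := by
    revert g
    simp only [mem_kummerPlane]
    intro g hg _
    refine forall_mem_symmetryGroup
      (p := fun g => ∃ t : ℂ, ¬ g ![t, 2 * t + 1, 3 - t] 2 =
        1 + g ![t, 2 * t + 1, 3 - t] 0 - g ![t, 2 * t + 1, 3 - t] 1) ?_ ?_ ?_ ?_ g hg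
    all_goals
      refine ⟨0, ?_⟩
      simp only [Matrix.cons_val]
      norm_num
  obtain ⟨t, ht⟩ := key
  exact ht (hsub ⟨_, componentLine_three_mem t, rfl⟩)

/-- It suffices that each of the four symmetries moves some point of `S` outside `S'`. In the
applications one parameter value, chosen to avoid accidental incidences, serves all four. -/
theorem not_equivalent_of_parametrization {S S' : Set Params21} (f : ℂ → Params21)
    (hf : ∀ t, f t ∈ S) (h1 : ∃ t, f t ∉ S') (h2 : ∃ t, ![f t 1, f t 0, f t 2] ∉ S')
    (h3 : ∃ t, ![f t 2 - f t 0, f t 2 - f t 1, f t 2] ∉ S')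
    (h4 : ∃ t, ![f t 2 - f t 1, f t 2 - f t 0, f t 2] ∉ S') : ¬ Equivalent S S' :=
  not_equivalent fun g hg => by
    obtain ⟨t, ht⟩ := forall_mem_symmetryGroup (p := fun g => ∃ t, g (f t) ∉ S') h1 h2 h3 h4 g hg
    exact ⟨f t, hf t, ht⟩

theorem not_equivalent_componentLine_zero_one :
    ¬ Equivalent (componentLine 0) (componentLine 1) := by
  refine not_equivalent_of_parametrization _ componentLine_zero_mem ?_ ?_ ?_ ?_ <;>
    (refine ⟨0, ?_⟩; simp only [mem_componentLine_one, Matrix.cons_val]; norm_num)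

theorem not_equivalent_componentLine_zero_two :
    ¬ Equivalent (componentLine 0) (componentLine 2) := by
  refine not_equivalent_of_parametrization _ componentLine_zero_mem ?_ ?_ ?_ ?_ <;>
    (refine ⟨1, ?_⟩; simp only [mem_componentLine_two, Matrix.cons_val]; norm_num)

theorem not_equivalent_componentLine_zero_three :
    ¬ Equivalent (componentLine 0) (componentLine 3) := by
  refine not_equivalent_of_parametrization _ componentLine_zero_mem ?_ ?_ ?_ ?_ <;>
    (refine ⟨7, ?_⟩; simp only [mem_componentLine_three, Matrix.cons_val]; norm_num)

theorem not_equivalent_componentLine_one_two :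
    ¬ Equivalent (componentLine 1) (componentLine 2) := by
  refine not_equivalent_of_parametrization _ componentLine_one_mem ?_ ?_ ?_ ?_ <;>
    (refine ⟨0, ?_⟩; simp only [mem_componentLine_two, Matrix.cons_val]; norm_num)

theorem not_equivalent_componentLine_one_three :
    ¬ Equivalent (componentLine 1) (componentLine 3) := by
  refine not_equivalent_of_parametrization _ componentLine_one_mem ?_ ?_ ?_ ?_ <;>
    (refine ⟨7, ?_⟩; simp only [mem_componentLine_three, Matrix.cons_val]; norm_num)

theorem not_equivalent_componentLine_two_three :
    ¬ Equivalent (componentLine 2) (componentLine 3) := by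
  refine not_equivalent_of_parametrization _ componentLine_two_mem ?_ ?_ ?_ ?_ <;>
    (refine ⟨7, ?_⟩; simp only [mem_componentLine_three, Matrix.cons_val]; norm_num)

theorem not_equivalent_componentLine {i j : Fin 4} (hij : i ≠ j) :
    ¬ Equivalent (componentLine i) (componentLine j) := by
  wlog hlt : i < j generalizing i j
  · exact fun h => this hij.symm (lt_of_le_of_ne (not_lt.1 hlt) hij.symm) h.symm
  fin_cases i <;> fin_cases j <;> first | exact absurd hlt (by decide) | skip
  exacts [not_equivalent_componentLine_zero_one, not_equivalent_componentLine_zero_two,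
    not_equivalent_componentLine_zero_three, not_equivalent_componentLine_one_two,
    not_equivalent_componentLine_one_three, not_equivalent_componentLine_two_three]

theorem not_equivalent_trivialLine (i : Fin 4) :
    ¬ Equivalent (componentLine i) trivialLine := by
  fin_cases i
  · refine not_equivalent_of_parametrization _ componentLine_zero_mem ?_ ?_ ?_ ?_ <;>
      (refine ⟨7, ?_⟩; simp only [mem_trivialLine, Matrix.cons_val]; norm_num)
  · refine not_equivalent_of_parametrization _ componentLine_one_mem ?_ ?_ ?_ ?_ <;>
      (refine ⟨7, ?_⟩; simp only [mem_trivialLine, Matrix.cons_val]; norm_num)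
  · refine not_equivalent_of_parametrization _ componentLine_two_mem ?_ ?_ ?_ ?_ <;>
      (refine ⟨7, ?_⟩; simp only [mem_trivialLine, Matrix.cons_val]; norm_num)
  · refine not_equivalent_of_parametrization _ componentLine_three_mem ?_ ?_ ?_ ?_ <;>
      (refine ⟨7, ?_⟩; simp only [mem_trivialLine, Matrix.cons_val]; norm_num)

/-! ### The two curves -/

/-- Here `t = α - β`: the defining equation is then linear in `β`. -/
theorem nonlinearCurve₁_mem (t : ℂ) :
    ![2 * t ^ 2 - 5 * t + 4, 3, -2 * t ^ 2 + 3 * t + 2] ∈ nonlinearCurve₁ := by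
  simp only [mem_nonlinearCurve₁, Matrix.cons_val, true_and]
  ring

theorem nonlinearCurve₂_mem (t : ℂ) :
    ![(2 * t ^ 2 - 9 * t + 13) / 3, 4, (-2 * t ^ 2 + 3 * t + 11) / 3] ∈ nonlinearCurve₂ := by
  simp only [mem_nonlinearCurve₂, Matrix.cons_val, true_and]
  ring

theorem not_equivalent_nonlinearCurves : ¬ Equivalent nonlinearCurve₁ nonlinearCurve₂ := by
  refine not_equivalent_of_parametrization _ nonlinearCurve₁_mem ?_ ?_ ?_ ?_ <;>
    (refine ⟨7, ?_⟩; simp only [mem_nonlinearCurve₂, Matrix.cons_val]; norm_num)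

/-- Three points of a line are linearly dependent in every pair of coordinates. -/
theorem IsLine.det_eq_zero {S : Set Params21} (hS : IsLine S) {a b c : Params21} (ha : a ∈ S)
    (hb : b ∈ S) (hc : c ∈ S) (i j : Fin 3) :
    (b i - a i) * (c j - a j) = (c i - a i) * (b j - a j) := by
  obtain ⟨p, v, -, rfl⟩ := hS
  obtain ⟨r, rfl⟩ := ha
  obtain ⟨s, rfl⟩ := hb
  obtain ⟨t, rfl⟩ := hc
  simp only [Pi.add_apply, Pi.smul_apply, smul_eq_mul]
  ring

theorem not_isLine_nonlinearCurve₁ : ¬ IsLine nonlinearCurve₁ := by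
  intro h
  have := h.det_eq_zero (nonlinearCurve₁_mem 0) (nonlinearCurve₁_mem 1) (nonlinearCurve₁_mem 2) 0 2
  simp only [Matrix.cons_val] at this
  norm_num at this

theorem not_isLine_nonlinearCurve₂ : ¬ IsLine nonlinearCurve₂ := by
  intro h
  have := h.det_eq_zero (nonlinearCurve₂_mem 0) (nonlinearCurve₂_mem 1) (nonlinearCurve₂_mem 2) 0 2
  simp only [Matrix.cons_val] at this
  norm_num at this

/-- A subset of the space with a polynomial parametrization by `ℂ`, of which one polynomial
function of the coordinates is a left inverse, is an irreducible algebraic curve. -/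
theorem isAlgebraicCurve_of_parametrization (f : Fin 3 → Polynomial ℂ)
    (g : MvPolynomial (Fin 3) ℂ) (hg : MvPolynomial.aeval f g = Polynomial.X) :
    IsAlgebraicCurve (Set.range fun (t : ℂ) i => (f i).eval t) := by
  have hev (t : ℂ) (P : MvPolynomial (Fin 3) ℂ) :
      MvPolynomial.eval (fun i => (f i).eval t) P = (MvPolynomial.aeval f P).eval t := by
    induction P using MvPolynomial.induction_on with
    | C a => simp
    | add P Q hP hQ => simp [hP, hQ]
    | mul_X P i hP => simp [hP]
  -- The left inverse `g` makes the coordinate ring all of `ℂ[t]`, a principal ideal domain that is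
  -- not a field. This gives primality of the kernel and dimension one.
  have hsurj : Function.Surjective (MvPolynomial.aeval f : MvPolynomial (Fin 3) ℂ →ₐ[ℂ] _) := by
    intro P
    refine ⟨Polynomial.aeval g P, ?_⟩
    rw [← Polynomial.aeval_algHom_apply, hg, Polynomial.aeval_X_left_apply]
  refine ⟨RingHom.ker (MvPolynomial.aeval f : MvPolynomial (Fin 3) ℂ →ₐ[ℂ] Polynomial ℂ),
    RingHom.ker_isPrime _, ?_, ?_⟩
  · rw [ringKrullDim_eq_of_ringEquiv (Ideal.quotientKerAlgEquivOfSurjective hsurj).toRingEquiv]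
    exact IsPrincipalIdealRing.ringKrullDim_eq_one _ (Polynomial.not_isField ℂ)
  · ext q
    constructor
    · rintro ⟨t, rfl⟩ P hP
      rw [hev, (RingHom.mem_ker).1 hP, Polynomial.eval_zero]
    · intro hq
      refine ⟨MvPolynomial.eval q g, ?_⟩
      funext i
      -- These elements of the kernel force any common zero `q` to be the point with parameter
      -- `g(q)`.
      have h := hq (MvPolynomial.X i - Polynomial.aeval g (f i)) <| by
        rw [RingHom.mem_ker, map_sub, MvPolynomial.aeval_X, ← Polynomial.aeval_algHom_apply, hg,
          Polynomial.aeval_X_left_apply, sub_self]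
      rw [map_sub, MvPolynomial.eval_X, sub_eq_zero] at h
      rw [h, ← MvPolynomial.coe_aeval_eq_eval, RingHom.coe_coe,
        ← Polynomial.aeval_algHom_apply, Polynomial.coe_aeval_eq_eval]

open Polynomial in
theorem isAlgebraicCurve_nonlinearCurve₁ : IsAlgebraicCurve nonlinearCurve₁ := by
  convert isAlgebraicCurve_of_parametrization ![2 * X ^ 2 - 5 * X + 4, 3, -2 * X ^ 2 + 3 * X + 2]
    (MvPolynomial.C (-1 / 2) * (MvPolynomial.X 0 + MvPolynomial.X 2 - 6)) ?_ using 1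
  · ext q
    constructor
    · intro h
      obtain ⟨h1, h2⟩ := mem_nonlinearCurve₁.1 h
      -- On the curve `q 0 + q 2 = 6 - 2t`.
      refine ⟨-1 / 2 * (q 0 + q 2 - 6), ?_⟩
      funext i
      fin_cases i <;> simp [h1]
      · linear_combination h2 / 2
      · linear_combination -h2 / 2
    · rintro ⟨t, rfl⟩
      convert nonlinearCurve₁_mem t using 1
      funext i
      fin_cases i <;> simp
  · simp only [map_mul, map_sub, map_add, MvPolynomial.aeval_X, MvPolynomial.aeval_C, map_ofNat,
      Matrix.cons_val]
    have : algebraMap ℂ ℂ[X] (-1 / 2) * (-2) = 1 := by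
      rw [show (-2 : ℂ[X]) = algebraMap ℂ ℂ[X] (-2) by rw [map_neg, map_ofNat], ← map_mul]
      norm_num
    linear_combination X * this

open Polynomial in
theorem isAlgebraicCurve_nonlinearCurve₂ : IsAlgebraicCurve nonlinearCurve₂ := by
  convert isAlgebraicCurve_of_parametrization
    ![C (1 / 3) * (2 * X ^ 2 - 9 * X + 13), 4, C (1 / 3) * (-2 * X ^ 2 + 3 * X + 11)]
    (MvPolynomial.C (-1 / 2) * (MvPolynomial.X 0 + MvPolynomial.X 2 - 8)) ?_ using 1
  · ext q
    constructor
    · intro h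
      obtain ⟨h1, h2⟩ := mem_nonlinearCurve₂.1 h
      refine ⟨-1 / 2 * (q 0 + q 2 - 8), ?_⟩
      funext i
      fin_cases i <;> simp [h1]
      · linear_combination h2 / 6
      · linear_combination -h2 / 6
    · rintro ⟨t, rfl⟩
      convert nonlinearCurve₂_mem t using 1
      funext i
      fin_cases i <;> simp <;> ring
  · simp only [map_mul, map_sub, map_add, MvPolynomial.aeval_X, MvPolynomial.aeval_C, map_ofNat,
      Matrix.cons_val]
    have h1 : algebraMap ℂ ℂ[X] (-1 / 2) * (-2) = 1 := by
      rw [show (-2 : ℂ[X]) = algebraMap ℂ ℂ[X] (-2) by rw [map_neg, map_ofNat], ← map_mul]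
      norm_num
    have h2 : (C (1 / 3) : ℂ[X]) * 3 = 1 := by
      rw [show (3 : ℂ[X]) = C 3 from (map_ofNat C 3).symm, ← C_mul]
      norm_num
    linear_combination X * h1 + algebraMap ℂ ℂ[X] (-1 / 2) * (8 - 2 * X) * h2

/-! ### The series -/

/-- The ratio of Pochhammer symbols `(a)ₖ / (c)ₖ`, with alternating sign. -/
noncomputable def pochhammerRatio (a c : ℂ) (k : ℕ) : ℂ :=
  (ascPochhammer ℂ k).eval a * ((ascPochhammer ℂ k).eval c)⁻¹ * (-1) ^ k

theorem pochhammerRatio_zero (a c : ℂ) : pochhammerRatio a c 0 = 1 := by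
  simp [pochhammerRatio]

theorem pochhammerRatio_succ {a c : ℂ} (hc : ∀ n : ℕ, c ≠ -(n : ℂ)) (k : ℕ) :
    (c + k) * pochhammerRatio a c (k + 1) = -((a + k) * pochhammerRatio a c k) := by
  have h : c + k ≠ 0 := fun h => hc k (eq_neg_of_add_eq_zero_left h)
  simp only [pochhammerRatio, ascPochhammer_succ_eval, mul_inv, pow_succ]
  field_simp

theorem ascPochhammer_eval_three (k : ℕ) :
    (ascPochhammer ℂ k).eval 3 = k.factorial * ((k + 1) * (k + 2) / 2) := by
  induction k with
  | zero => simp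
  | succ k ih =>
    rw [ascPochhammer_succ_eval, ih, Nat.factorial_succ]
    push_cast
    ring

theorem ascPochhammer_eval_four (k : ℕ) :
    (ascPochhammer ℂ k).eval 4 = k.factorial * ((k + 1) * (k + 2) * (k + 3) / 6) := by
  induction k with
  | zero => norm_num
  | succ k ih =>
    rw [ascPochhammer_succ_eval, ih, Nat.factorial_succ]
    push_cast
    ring

/-- The quotient `(3)ₖ / k!` is a polynomial in `k`, which makes telescoping possible. -/
theorem coefficient_three (a c : ℂ) (k : ℕ) :
    ordinaryHypergeometricCoefficient a 3 c k * (-1) ^ k =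
      (k + 1) * (k + 2) / 2 * pochhammerRatio a c k := by
  have h : (k.factorial : ℂ) ≠ 0 := Nat.cast_ne_zero.2 k.factorial_ne_zero
  rw [ordinaryHypergeometricCoefficient, ascPochhammer_eval_three, pochhammerRatio]
  field_simp

theorem coefficient_four (a c : ℂ) (k : ℕ) :
    ordinaryHypergeometricCoefficient a 4 c k * (-1) ^ k =
      (k + 1) * (k + 2) * (k + 3) / 6 * pochhammerRatio a c k := by
  have h : (k.factorial : ℂ) ≠ 0 := Nat.cast_ne_zero.2 k.factorial_ne_zero
  rw [ordinaryHypergeometricCoefficient, ascPochhammer_eval_four, pochhammerRatio]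
  field_simp

theorem tendsto_zero_of_tendsto_sum_range {t : ℕ → ℂ} {s : ℂ}
    (h : Tendsto (fun N => ∑ k ∈ Finset.range N, t k) atTop (𝓝 s)) : Tendsto t atTop (𝓝 0) := by
  have h1 := (h.comp (tendsto_add_atTop_nat 1)).sub h
  rw [sub_self] at h1
  refine h1.congr fun N => ?_
  simp [Finset.sum_range_succ]

/-- If the terms of a convergent series are the differences of a sequence that is asymptotically
at most proportional to them, then the sum is determined by the first term of the sequence. -/
theorem tendsto_sum_range_of_telescoping {t S ρ : ℕ → ℂ} {s L : ℂ}
    (h : Tendsto (fun N => ∑ k ∈ Finset.range N, t k) atTop (𝓝 s))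
    (hS : ∀ k, S (k + 1) - S k = t k) (hρ : Tendsto ρ atTop (𝓝 L)) (hSt : ∀ k, S k = ρ k * t k) :
    Tendsto (fun N => ∑ k ∈ Finset.range N, t k) atTop (𝓝 (-S 0)) := by
  have h0 : Tendsto S atTop (𝓝 0) := by
    have := hρ.mul (tendsto_zero_of_tendsto_sum_range h)
    rw [mul_zero] at this
    exact this.congr fun k => (hSt k).symm
  have h1 := h0.sub_const (S 0)
  rw [zero_sub] at h1
  refine h1.congr fun N => ?_
  rw [← Finset.sum_range_sub]
  exact Finset.sum_congr rfl fun k _ => hS k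

theorem tendsto_inv_natCast_add (m : ℕ) :
    Tendsto (fun N : ℕ => ((N : ℂ) + m)⁻¹) atTop (𝓝 0) := by
  refine ((tendsto_inv_atTop_nhds_zero_nat (𝕜 := ℂ)).comp (tendsto_add_atTop_nat m)).congr
    fun N => ?_
  simp

theorem natCast_add_ne_zero (k m : ℕ) (hm : m ≠ 0) : (k : ℂ) + m ≠ 0 := by
  rw [← Nat.cast_add, Nat.cast_ne_zero]
  omega

/-! ### Divergence where a denominator of the closed forms vanishes -/

theorem not_hasSum21_of_one_le {a b c s : ℂ}
    (h : ∀ k : ℕ, 1 ≤ ‖ordinaryHypergeometricCoefficient a b c k * (-1) ^ k‖) :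
    ¬ HasSum21 a b c (-1) s := by
  rintro ⟨-, hs⟩
  have h1 := (tendsto_zero_of_tendsto_sum_range hs).norm
  rw [norm_zero] at h1
  exact absurd (ge_of_tendsto' h1 h) (by norm_num)

theorem pochhammerRatio_one_two (k : ℕ) : pochhammerRatio 1 2 k = (-1) ^ k / (k + 1) := by
  have hc (n : ℕ) : (2 : ℂ) ≠ -(n : ℂ) := fun h => natCast_add_ne_zero n 2 two_ne_zero <| by
    push_cast
    linear_combination h
  induction k with
  | zero => simp [pochhammerRatio_zero]
  | succ k ih =>
    have h := pochhammerRatio_succ (a := 1) hc k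
    have h1 := natCast_add_ne_zero k 1 one_ne_zero
    have h2 := natCast_add_ne_zero k 2 two_ne_zero
    push_cast at h1 h2 ⊢
    have h3 : (k : ℂ) + 1 + 1 ≠ 0 := by convert h2 using 1; ring
    rw [ih] at h
    field_simp at h
    rw [eq_div_iff h3]
    refine mul_left_cancel₀ h1 ?_
    linear_combination h

theorem pochhammerRatio_one_three (k : ℕ) :
    pochhammerRatio 1 3 k = 2 * (-1) ^ k / ((k + 1) * (k + 2)) := by
  have hc (n : ℕ) : (3 : ℂ) ≠ -(n : ℂ) := fun h => natCast_add_ne_zero n 3 three_ne_zero <| by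
    push_cast
    linear_combination h
  induction k with
  | zero => simp [pochhammerRatio_zero]
  | succ k ih =>
    have h := pochhammerRatio_succ (a := 1) hc k
    have h1 := natCast_add_ne_zero k 1 one_ne_zero
    have h2 := natCast_add_ne_zero k 2 two_ne_zero
    have h3 := natCast_add_ne_zero k 3 three_ne_zero
    push_cast at h1 h2 h3 ⊢
    have h4 : ((k : ℂ) + 1 + 1) * (k + 1 + 2) ≠ 0 := by
      convert mul_ne_zero h2 h3 using 1; ring
    rw [ih] at h
    field_simp at h
    rw [eq_div_iff h4]
    refine mul_left_cancel₀ h1 ?_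
    linear_combination h

/-- The point `α = 1/2`, `β = -1` of the first curve; the terms are `(-1)ᵏ (k + 2) / 2`. -/
theorem not_hasSum21_one_three_two (s : ℂ) : ¬ HasSum21 1 3 2 (-1) s := by
  refine not_hasSum21_of_one_le fun k => ?_
  have h1 := natCast_add_ne_zero k 1 one_ne_zero
  push_cast at h1
  have h : (k + 1 : ℂ) * (k + 2) / 2 * ((-1) ^ k / (k + 1)) =
      (1 / 2 : ℝ) * ((k + 2 : ℕ) * (-1) ^ k) := by
    push_cast
    field_simp
  rw [coefficient_three, pochhammerRatio_one_two, h, norm_mul, norm_mul, Complex.norm_real,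
    Complex.norm_natCast]
  simp
  have : (0 : ℝ) ≤ k := Nat.cast_nonneg k
  linarith

/-- The point `α = 1`, `β = -1` of the second curve; the terms are `(-1)ᵏ (k + 3) / 3`. -/
theorem not_hasSum21_one_four_three (s : ℂ) : ¬ HasSum21 1 4 3 (-1) s := by
  refine not_hasSum21_of_one_le fun k => ?_
  have h1 := natCast_add_ne_zero k 1 one_ne_zero
  have h2 := natCast_add_ne_zero k 2 two_ne_zero
  push_cast at h1 h2
  have h : (k + 1 : ℂ) * (k + 2) * (k + 3) / 6 * (2 * (-1) ^ k / ((k + 1) * (k + 2))) =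
      (1 / 3 : ℝ) * ((k + 3 : ℕ) * (-1) ^ k) := by
    push_cast
    field_simp
    ring
  rw [coefficient_four, pochhammerRatio_one_three, h, norm_mul, norm_mul, Complex.norm_real,
    Complex.norm_natCast]
  simp
  have : (0 : ℝ) ≤ k := Nat.cast_nonneg k
  linarith

/-- The point `α = 1/2`, `β = -2` of the second curve; the terms are `(-1)ᵏ (k + 2)(k + 3) / 6`. -/
theorem not_hasSum21_one_four_two (s : ℂ) : ¬ HasSum21 1 4 2 (-1) s := by
  refine not_hasSum21_of_one_le fun k => ?_
  have h1 := natCast_add_ne_zero k 1 one_ne_zero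
  push_cast at h1
  have h : (k + 1 : ℂ) * (k + 2) * (k + 3) / 6 * ((-1) ^ k / (k + 1)) =
      (1 / 6 : ℝ) * (((k + 2) * (k + 3) : ℕ) * (-1) ^ k) := by
    push_cast
    field_simp
  rw [coefficient_four, pochhammerRatio_one_two, h, norm_mul, norm_mul, Complex.norm_real,
    Complex.norm_natCast]
  simp
  have : (0 : ℝ) ≤ k := Nat.cast_nonneg k
  nlinarith

/-- Seek `S k = (k + c - 1) p(k) rₖ`, with `rₖ` the Pochhammer ratio. Its recurrence reduces
telescoping to `-(a + k) p(k + 1) - (k + c - 1) p(k) = (k + 1)(k + 2) / 2`. The coefficients of `k²`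
and `k` determine an affine `p`, and the constant term is then the equation of the curve. -/
theorem hasSum21_nonlinearCurve₁ {α β s : ℂ} (h : 2 * (α - β) ^ 2 - 3 * α + 4 * β + 1 = 0)
    (hs : HasSum21 (β - 2 * α + 3) 3 (β + 3) (-1) s) :
    HasSum21 (β - 2 * α + 3) 3 (β + 3) (-1)
      (1 / 4 * ((β + 1) * (β + 2) / (2 * β - 2 * α + 3))) := by
  have hne : 2 * β - 2 * α + 3 ≠ 0 := by
    intro h0
    have hα : α = 1 / 2 := by linear_combination h + (α - β - 1 / 2) * h0
    have hβ : β = -1 := by linear_combination hα + h0 / 2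
    refine not_hasSum21_one_three_two s ?_
    convert hs using 1 <;> rw [hβ]
    · rw [hα]; norm_num
    · norm_num
  obtain ⟨hc, hs⟩ := hs
  refine ⟨hc, ?_⟩
  have hval : 1 / 4 * ((β + 1) * (β + 2) / (2 * β - 2 * α + 3)) = (β + 2) * (α - β) / 4 := by
    rw [← mul_div_assoc, div_eq_div_iff hne (by norm_num)]
    linear_combination (β + 2) * h
  simp only [coefficient_three] at hs ⊢
  set a := β - 2 * α + 3 with ha
  have key := tendsto_sum_range_of_telescoping hs
    (S := fun k => (k + (β + 2)) * ((β - α - k) / 4) * pochhammerRatio a (β + 3) k)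
    -- This is `S k` divided by the `k`-th term, expanded in reciprocals so that its limit is
    -- visible.
    (ρ := fun k => -(1 / 2) * (1 + (β + 1) * ((k : ℂ) + (1 : ℕ))⁻¹) *
      (1 + (α - β - 2) * ((k : ℂ) + (2 : ℕ))⁻¹)) (L := -(1 / 2) * (1 + (β + 1) * 0) *
      (1 + (α - β - 2) * 0)) ?_ ?_ ?_
  · convert key using 2
    rw [hval, pochhammerRatio_zero]
    push_cast
    ring
  · intro k
    have hk := pochhammerRatio_succ (a := a) hc k
    push_cast
    rw [ha] at hk ⊢
    linear_combination (β - α - k - 1) / 4 * hk - pochhammerRatio (β - 2 * α + 3) (β + 3) k / 4 * h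
  · exact (((tendsto_inv_natCast_add 1).const_mul _).const_add _ |>.const_mul _).mul
      (((tendsto_inv_natCast_add 2).const_mul _).const_add _)
  · intro k
    have h1 := natCast_add_ne_zero k 1 one_ne_zero
    have h2 := natCast_add_ne_zero k 2 two_ne_zero
    push_cast at h1 h2 ⊢
    field_simp
    ring

/-- The same method with a quadratic `p`, whose coefficients are written in `α - β` alone; the
telescoping identity holds up to a multiple of the curve's equation. -/
theorem hasSum21_nonlinearCurve₂ {α β s : ℂ} (h : 2 * (α - β) ^ 2 - 3 * α + 6 * β + 1 = 0)
    (hs : HasSum21 (β - 2 * α + 4) 4 (β + 4) (-1) s) :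
    HasSum21 (β - 2 * α + 4) 4 (β + 4) (-1)
      (1 / 4 * ((β + 1) * (β + 2) * (β + 3) /
        ((2 * β - 2 * α + 4) * (2 * β - 2 * α + 5)))) := by
  have hne1 : 2 * β - 2 * α + 4 ≠ 0 := by
    intro h0
    have hα : α = 1 := by linear_combination h / 3 + (α - β + 2 - 3) / 3 * h0
    have hβ : β = -1 := by linear_combination hα + h0 / 2
    refine not_hasSum21_one_four_three s ?_
    convert hs using 1 <;> rw [hβ]
    · rw [hα]; norm_num
    · norm_num
  have hne2 : 2 * β - 2 * α + 5 ≠ 0 := by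
    intro h0
    have hα : α = 1 / 2 := by linear_combination h / 3 + (α - β + 5 / 2 - 3) / 3 * h0
    have hβ : β = -2 := by linear_combination hα + h0 / 2
    refine not_hasSum21_one_four_two s ?_
    convert hs using 1 <;> rw [hβ]
    · rw [hα]; norm_num
    · norm_num
  obtain ⟨hc, hs⟩ := hs
  refine ⟨hc, ?_⟩
  have hβ : β = -(2 * (α - β) ^ 2 - 3 * (α - β) + 1) / 3 := by linear_combination h / 3
  have hval : 1 / 4 * ((β + 1) * (β + 2) * (β + 3) /
      ((2 * β - 2 * α + 4) * (2 * β - 2 * α + 5))) =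
      (β + 3) * (2 * (α - β) + 1) * (α - β + 1) / 72 := by
    -- On the curve `β + 1` and `β + 2` are quadratics in `α - β` that split, each with one factor
    -- cancelling a factor of the denominator.
    have h1 : β + 1 = -(2 * (α - β) + 1) * (α - β - 2) / 3 := by linear_combination hβ
    have h2 : β + 2 = -(2 * (α - β) - 5) * (α - β + 1) / 3 := by linear_combination hβ
    rw [← mul_div_assoc, div_eq_div_iff (mul_ne_zero hne1 hne2) (by norm_num), h1, h2]
    ring
  simp only [coefficient_four] at hs ⊢
  set a := β - 2 * α + 4 with ha
  have key := tendsto_sum_range_of_telescoping hs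
    (S := fun k => (k + (β + 3)) * (-(2 * (α - β) + 1) * (α - β + 1) / 72
      - (2 * (α - β) + 3) / 24 * k - k ^ 2 / 12) * pochhammerRatio a (β + 4) k)
    -- The second factor is `6 p(k) / ((k + 2)(k + 3))`, with `p` expanded in the basis `(k + 2)(k +
    -- 3)`, `k + 2`, `1`.
    (ρ := fun k => (1 + (β + 2) * ((k : ℂ) + (1 : ℕ))⁻¹) *
      (-(1 / 2) - (2 * (α - β) - 7) / 4 * ((k : ℂ) + (3 : ℕ))⁻¹ +
        (-(2 * (α - β) + 1) * (α - β + 1) / 12 + (2 * (α - β) + 3) / 2 - 2) *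
          (((k : ℂ) + (2 : ℕ))⁻¹ * ((k : ℂ) + (3 : ℕ))⁻¹)))
    (L := (1 + (β + 2) * 0) *
      (-(1 / 2) - (2 * (α - β) - 7) / 4 * 0 +
        (-(2 * (α - β) + 1) * (α - β + 1) / 12 + (2 * (α - β) + 3) / 2 - 2) * (0 * 0))) ?_ ?_ ?_
  · convert key using 2
    rw [hval, pochhammerRatio_zero]
    push_cast
    ring
  · intro k
    have hk := pochhammerRatio_succ (a := a) hc k
    push_cast
    rw [ha] at hk ⊢
    linear_combination (-(2 * (α - β) + 1) * (α - β + 1) / 72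
      - (2 * (α - β) + 3) / 24 * (k + 1) - (k + 1) ^ 2 / 12) * hk
      - (k / 18 + (α - β) / 36 + 5 / 72) * pochhammerRatio (β - 2 * α + 4) (β + 4) k * h
  · have t1 := tendsto_inv_natCast_add 1
    have t2 := tendsto_inv_natCast_add 2
    have t3 := tendsto_inv_natCast_add 3
    exact ((t1.const_mul _).const_add _).mul
      (((t3.const_mul _).const_sub _).add ((t2.mul t3).const_mul _))
  · intro k
    have h1 := natCast_add_ne_zero k 1 one_ne_zero
    have h2 := natCast_add_ne_zero k 2 two_ne_zero
    have h3 := natCast_add_ne_zero k 3 three_ne_zero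
    push_cast at h1 h2 h3 ⊢
    field_simp
    ring

end Hypergeometric

theorem mainTheorem7 :
    -- the intersection, up to permutations and Euler's transformation
    (∃ ℓ : Fin 4 → Set Hypergeometric.Params21,
      (∀ i, Hypergeometric.IsLine (ℓ i)) ∧
      (∀ i, i ≠ 3 → ℓ i ⊆ Hypergeometric.kummerPlane) ∧
      ℓ 3 ⊆ Hypergeometric.displacedPlane (-4) ∧
      (∀ i j, i ≠ j → ¬ Hypergeometric.Equivalent (ℓ i) (ℓ j)) ∧
      (∀ i, ¬ Hypergeometric.Equivalent (ℓ i) Hypergeometric.trivialLine) ∧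
      (∀ g ∈ Hypergeometric.symmetryGroup, ¬ g '' ℓ 3 ⊆ Hypergeometric.kummerPlane) ∧
      Hypergeometric.saturation Hypergeometric.projectedIntersection =
        Hypergeometric.saturation
          ((⋃ i, ℓ i) ∪ Hypergeometric.nonlinearCurve₁ ∪ Hypergeometric.nonlinearCurve₂ ∪
            Hypergeometric.trivialLine)) ∧
    -- the two remaining components are curves other than lines
    Hypergeometric.IsAlgebraicCurve Hypergeometric.nonlinearCurve₁ ∧
    Hypergeometric.IsAlgebraicCurve Hypergeometric.nonlinearCurve₂ ∧
    ¬ Hypergeometric.IsLine Hypergeometric.nonlinearCurve₁ ∧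
    ¬ Hypergeometric.IsLine Hypergeometric.nonlinearCurve₂ ∧
    ¬ Hypergeometric.Equivalent Hypergeometric.nonlinearCurve₁ Hypergeometric.nonlinearCurve₂ ∧
    -- the evaluations on the two curves, wherever the series converges
    (∀ α β : ℂ, 2 * (α - β) ^ 2 - 3 * α + 4 * β + 1 = 0 →
      (∃ s, Hypergeometric.HasSum21 (β - 2 * α + 3) 3 (β + 3) (-1) s) →
      Hypergeometric.HasSum21 (β - 2 * α + 3) 3 (β + 3) (-1)
        (1 / 4 * ((β + 1) * (β + 2) / (2 * β - 2 * α + 3)))) ∧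
    (∀ α β : ℂ, 2 * (α - β) ^ 2 - 3 * α + 6 * β + 1 = 0 →
      (∃ s, Hypergeometric.HasSum21 (β - 2 * α + 4) 4 (β + 4) (-1) s) →
      Hypergeometric.HasSum21 (β - 2 * α + 4) 4 (β + 4) (-1)
        (1 / 4 * ((β + 1) * (β + 2) * (β + 3) /
          ((2 * β - 2 * α + 4) * (2 * β - 2 * α + 5))))) := by
  open Hypergeometric in
  exact ⟨⟨componentLine, isLine_componentLine, componentLine_subset_kummerPlane,
    componentLine_subset_displacedPlane, fun _ _ => not_equivalent_componentLine,
    not_equivalent_trivialLine, not_image_subset_kummerPlane, saturation_projectedIntersection⟩,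
    isAlgebraicCurve_nonlinearCurve₁, isAlgebraicCurve_nonlinearCurve₂,
    not_isLine_nonlinearCurve₁, not_isLine_nonlinearCurve₂, not_equivalent_nonlinearCurves,
    fun _ _ h ⟨_, hs⟩ => hasSum21_nonlinearCurve₁ h hs,
    fun _ _ h ⟨_, hs⟩ => hasSum21_nonlinearCurve₂ h hs⟩
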